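/- Let $X$ and $Y$ be real Banach spaces, $X \neq \{0\}$. Suppose that $X$ is almost square (ASQ), that is, for all $x_1,\dots,x_n$ in the unit sphere $S_X$ there is a sequence $(y_k)$ in $S_X$ such that $\|x_i + y_k\| \to 1$ and $\|x_i - y_k\| \to 1$ as $k\to\infty$ for every $i \in \{1,\dots,n\}$. Suppose also that the norm of $Y$ is octahedral, where the norm of a real normed space $Z$ is called octahedral if for every $\varepsilon > 0$ and every finite-dimensional subspace $F \subseteq Z$ there is $z \in S_Z$ such that $\|y + \lambda z\| \ge (1-\varepsilon)(\|y\| + |\lambda|)$ for all $y \in F$ and $\lambda \in \mathbb{R}$. Then for every integer $N \ge 0$ the space $\mathcal{P}(^N X, Y)$ has an octahedral norm. Here $\mathcal{P}(^N X, Y)$ is the space of bounded $N$-homogeneous polynomials from $X$ to $Y$, i.e. of the maps $x \mapsto M(x,\dots,x)$ with $M : X^N \to Y$ continuous and $N$-linear (constant maps if $N = 0$), with the norm $\|P\| = \sup_{\|x\| \le 1} \|P(x)\|$. -/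

import Mathlib

open Filter Topology

/-- A real Banach space `X` is *almost square* (ASQ) if for all `x₁, …, xₙ` in the unit sphere there
is a sequence `(yₖ)` in the unit sphere with `‖xᵢ ± yₖ‖ → 1` for every `i`.
(The empty family `n = 0` only says that the unit sphere is nonempty, i.e. that `X ≠ 0`.) -/
def IsASQ (X : Type*) [NormedAddCommGroup X] : Prop :=
  ∀ (n : ℕ) (x : Fin n → X), (∀ i, ‖x i‖ = 1) →
    ∃ y : ℕ → X, (∀ k, ‖y k‖ = 1) ∧
      ∀ i, Tendsto (fun k => ‖x i + y k‖) atTop (𝓝 1) ∧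
        Tendsto (fun k => ‖x i - y k‖) atTop (𝓝 1)

/-- The norm of a real normed space `X` is *octahedral* if for every `ε > 0` and every
finite-dimensional subspace `F` there is `x` in the unit sphere with
`‖y + t x‖ ≥ (1 - ε) (‖y‖ + |t|)` for all `y ∈ F` and all real `t`. -/
def HasOctahedralNorm (X : Type*) [NormedAddCommGroup X] [NormedSpace ℝ X] : Prop :=
  ∀ ε : ℝ, 0 < ε → ∀ F : Submodule ℝ X, FiniteDimensional ℝ F →
    ∃ x : X, ‖x‖ = 1 ∧ ∀ y ∈ F, ∀ t : ℝ, (1 - ε) * (‖y‖ + |t|) ≤ ‖y + t • x‖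

/-- The linear space of bounded (i.e. continuous) `N`-homogeneous polynomials `X → Y`: the maps
`x ↦ M (x, …, x)` with `M` a continuous `N`-linear map. -/
def homPolySubmodule (N : ℕ) (X Y : Type*) [NormedAddCommGroup X] [NormedSpace ℝ X]
    [NormedAddCommGroup Y] [NormedSpace ℝ Y] : Submodule ℝ (X → Y) where
  carrier := {P | ∃ M : ContinuousMultilinearMap ℝ (fun _ : Fin N => X) Y,
    ∀ x, P x = M (fun _ => x)}
  add_mem' := by
    rintro P Q ⟨M, hM⟩ ⟨L, hL⟩
    exact ⟨M + L, fun x => by simp [hM, hL]⟩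
  zero_mem' := ⟨0, fun x => by simp⟩
  smul_mem' := by
    rintro c P ⟨M, hM⟩
    exact ⟨c • M, fun x => by simp [hM]⟩

/-- The space `P(^N X, Y)` of bounded `N`-homogeneous polynomials from `X` to `Y`, as a type of its
own, so that it carries the polynomial norm and not the topology of pointwise convergence. -/
def HomPoly (N : ℕ) (X Y : Type*) [NormedAddCommGroup X] [NormedSpace ℝ X]
    [NormedAddCommGroup Y] [NormedSpace ℝ Y] : Type _ :=
  ↥(homPolySubmodule N X Y)

namespace HomPoly

variable {N : ℕ} {X Y : Type*} [NormedAddCommGroup X] [NormedSpace ℝ X]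
  [NormedAddCommGroup Y] [NormedSpace ℝ Y]

instance instAddCommGroup : AddCommGroup (HomPoly N X Y) :=
  inferInstanceAs (AddCommGroup ↥(homPolySubmodule N X Y))

instance instModule : Module ℝ (HomPoly N X Y) :=
  inferInstanceAs (Module ℝ ↥(homPolySubmodule N X Y))

instance instCoeFun : CoeFun (HomPoly N X Y) (fun _ => X → Y) :=
  ⟨fun P => P.1⟩

theorem ext_fun {P Q : HomPoly N X Y} (h : ∀ x, P x = Q x) : P = Q :=
  Subtype.ext (funext h)

theorem zero_apply (x : X) : (0 : HomPoly N X Y) x = 0 := rfl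

theorem add_apply (P Q : HomPoly N X Y) (x : X) : (P + Q) x = P x + Q x := rfl

theorem smul_apply (c : ℝ) (P : HomPoly N X Y) (x : X) : (c • P) x = c • P x := rfl

/-- The usual norm `‖P‖ = sup {‖P x‖ : ‖x‖ ≤ 1}`. -/
noncomputable instance instNorm : Norm (HomPoly N X Y) :=
  ⟨fun P => ⨆ x : Metric.closedBall (0 : X) 1, ‖P x‖⟩

theorem norm_def (P : HomPoly N X Y) : ‖P‖ = ⨆ x : Metric.closedBall (0 : X) 1, ‖P x‖ := rfl

instance instNonemptyBall : Nonempty (Metric.closedBall (0 : X) 1) :=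
  ⟨⟨0, by simp⟩⟩

theorem bddAbove (P : HomPoly N X Y) :
    BddAbove (Set.range fun x : Metric.closedBall (0 : X) 1 => ‖P x‖) := by
  obtain ⟨M, hM⟩ := P.2
  refine ⟨‖M‖, ?_⟩
  rintro _ ⟨⟨x, hx⟩, rfl⟩
  have hx' : ‖x‖ ≤ 1 := by simpa using hx
  have h1 := M.le_opNorm (fun _ => x)
  have h2 : (∏ _i : Fin N, ‖x‖) ≤ 1 := by
    simpa using pow_le_one₀ (n := N) (norm_nonneg x) hx'
  calc ‖P x‖ = ‖M (fun _ => x)‖ := by rw [hM x]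
    _ ≤ ‖M‖ * ∏ _i : Fin N, ‖x‖ := h1
    _ ≤ ‖M‖ := mul_le_of_le_one_right (norm_nonneg M) h2

theorem apply_smul (P : HomPoly N X Y) (c : ℝ) (x : X) : P (c • x) = c ^ N • P x := by
  obtain ⟨M, hM⟩ := P.2
  rw [hM, hM]
  simpa using M.map_smul_univ (fun _ => c) (fun _ => x)

theorem le_norm (P : HomPoly N X Y) {x : X} (hx : ‖x‖ ≤ 1) : ‖P x‖ ≤ ‖P‖ :=
  le_ciSup (f := fun x : Metric.closedBall (0 : X) 1 => ‖P x‖) P.bddAbove ⟨x, by simpa using hx⟩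

theorem norm_core : NormedSpace.Core ℝ (HomPoly N X Y) where
  norm_nonneg P := Real.iSup_nonneg fun _ => norm_nonneg _
  norm_smul c P := by
    rw [norm_def, norm_def, Real.mul_iSup_of_nonneg (norm_nonneg c)]
    exact iSup_congr fun x => by rw [smul_apply, norm_smul]
  norm_triangle P Q := by
    rw [norm_def (P + Q)]
    refine ciSup_le fun x => ?_
    have hx : ‖(x : X)‖ ≤ 1 := mem_closedBall_zero_iff.1 x.2
    rw [add_apply]
    exact (norm_add_le _ _).trans (add_le_add (P.le_norm hx) (Q.le_norm hx))
  norm_eq_zero_iff P := by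
    constructor
    · intro h
      refine ext_fun fun x => ?_
      set r : ℝ := ‖x‖ + 1 with hr
      have hr0 : 0 < r := by positivity
      have hle : ‖r⁻¹ • x‖ ≤ 1 := by
        rw [norm_smul, norm_inv, Real.norm_of_nonneg hr0.le, inv_mul_le_iff₀ hr0]
        linarith
      have h0 : P (r⁻¹ • x) = 0 := norm_le_zero_iff.1 ((P.le_norm hle).trans h.le)
      have hx : x = r • (r⁻¹ • x) := by rw [smul_inv_smul₀ hr0.ne']
      rw [hx, apply_smul, h0, smul_zero, zero_apply]
    · rintro rfl
      rw [norm_def]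
      simp [zero_apply]

noncomputable instance instNormedAddCommGroup : NormedAddCommGroup (HomPoly N X Y) :=
  NormedAddCommGroup.ofCore norm_core

noncomputable instance instNormedSpace : NormedSpace ℝ (HomPoly N X Y) :=
  NormedSpace.ofCore norm_core

end HomPoly

/-! Given norm-one polynomials `P i`, take `x i` in the ball almost attaining their norms. Suppose a
unit vector `y` satisfies `‖x i ± y‖ ≤ 1 + δ` and `P i (x i + y)` still has norm almost 1. With `f`
norming `y` and `z` an octahedral direction of `Y` for the span of the `P i (x i + y)`, the
polynomial `Q = f ^ N • z` works: evaluate `P i + t • Q` at `x i + y`, where `f` is almost at least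
1.

Such a `y` exists because an almost square space contains arbitrarily long families whose signed
sums are all bounded by 2 (`IsASQ.exists_family`). Along such a family the increments of a scalar
polynomial are absolutely summable with a bound independent of the length
(`exists_sum_increments_le`), so in a long family some member has small increments. -/

/-- In an almost square space, every finite set of vectors has an almost orthogonal companion, in
the sense of the supremum norm. -/
theorem IsASQ.exists_norm_add_sub_le {X : Type*} [NormedAddCommGroup X] [NormedSpace ℝ X]
    (hX : IsASQ X) (T : Finset X) {δ : ℝ} (hδ : 0 < δ) :
    ∃ y : X, ‖y‖ = 1 ∧ ∀ u ∈ T, ‖u + y‖ ≤ max 1 ‖u‖ + δ ∧ ‖u - y‖ ≤ max 1 ‖u‖ + δ := by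
  classical
  -- The empty family yields a unit vector, which serves as the direction of `u = 0`.
  obtain ⟨e₀, he₀, -⟩ := hX 0 (fun i => i.elim0) (fun i => i.elim0)
  have key : ∀ u : X, ∃ e : X, ‖e‖ = 1 ∧ u = ‖u‖ • e := by
    intro u
    by_cases hu : u = 0
    · exact ⟨e₀ 0, he₀ 0, by simp [hu]⟩
    · have hu' : ‖u‖ ≠ 0 := norm_ne_zero_iff.2 hu
      exact ⟨‖u‖⁻¹ • u, by rw [norm_smul, norm_inv, norm_norm, inv_mul_cancel₀ hu'],
        by rw [smul_inv_smul₀ hu']⟩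
  choose e he hue using key
  obtain ⟨y, hy, hlim⟩ := hX T.card (fun i => e (T.equivFin.symm i)) (fun i => he _)
  have hev : ∀ᶠ k in atTop, ∀ i : Fin T.card,
      ‖e (T.equivFin.symm i) + y k‖ < 1 + δ ∧ ‖e (T.equivFin.symm i) - y k‖ < 1 + δ := by
    rw [eventually_all]
    intro i
    exact ((hlim i).1.eventually_lt_const (by linarith)).and
      ((hlim i).2.eventually_lt_const (by linarith))
  obtain ⟨k, hk⟩ := hev.exists
  have bound : ∀ (a : ℝ) (e w : X), 0 ≤ a → ‖e‖ = 1 → ‖w‖ = 1 → ‖e + w‖ < 1 + δ →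
      ‖a • e + w‖ ≤ max 1 a + δ := by
    intro a e w ha he hw hew
    rcases le_total a 1 with h | h
    · have h1 : a • e + w = a • (e + w) + (1 - a) • w := by module
      have h2 : ‖a • e + w‖ ≤ a * ‖e + w‖ + (1 - a) * ‖w‖ := by
        rw [h1]
        refine (norm_add_le _ _).trans (le_of_eq ?_)
        rw [norm_smul, norm_smul, Real.norm_of_nonneg ha, Real.norm_of_nonneg (sub_nonneg.2 h)]
      rw [max_eq_left h]
      rw [hw] at h2
      nlinarith
    · have h1 : a • e + w = (e + w) + (a - 1) • e := by module
      have h2 : ‖a • e + w‖ ≤ ‖e + w‖ + (a - 1) * ‖e‖ := by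
        rw [h1]
        refine (norm_add_le _ _).trans (le_of_eq ?_)
        rw [norm_smul, Real.norm_of_nonneg (sub_nonneg.2 h)]
      rw [max_eq_right h]
      rw [he] at h2
      linarith
  refine ⟨y k, hy k, fun u hu => ?_⟩
  have h := hk (T.equivFin ⟨u, hu⟩)
  rw [Equiv.symm_apply_apply] at h
  constructor
  · have := bound ‖u‖ (e u) (y k) (norm_nonneg _) (he u) (hy k) h.1
    rwa [← hue u] at this
  · have := bound ‖u‖ (e u) (-y k) (norm_nonneg _) (he u) (by rw [norm_neg, hy k])
      (by rw [← sub_eq_add_neg]; exact h.2)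
    rwa [← hue u, ← sub_eq_add_neg] at this

/-- In an almost square space, there are arbitrarily many companions of a finite set all of whose
signed sums are bounded by `2`. -/
theorem IsASQ.exists_family {X : Type*} [NormedAddCommGroup X] [NormedSpace ℝ X]
    (hX : IsASQ X) (T : Finset X) {δ : ℝ} (hδ : 0 < δ) (m : ℕ) :
    ∃ y : Fin m → X,
      (∀ k, ‖y k‖ = 1 ∧ ∀ u ∈ T, ‖u + y k‖ ≤ max 1 ‖u‖ + δ ∧ ‖u - y k‖ ≤ max 1 ‖u‖ + δ) ∧
      ∀ c : Fin m → ℝ, (∀ k, |c k| = 1) → ‖∑ k, c k • y k‖ ≤ 2 := by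
  classical
  -- The finite set `S` contains all signed sums so far, so the next companion can be chosen for `S`
  -- too. The bound `2 - (1 / 2) ^ m` leaves room for an error of `(1 / 2) ^ (m + 1)` at that step.
  suffices H : ∃ (y : Fin m → X) (S : Finset X),
      (∀ k, ‖y k‖ = 1 ∧ ∀ u ∈ T, ‖u + y k‖ ≤ max 1 ‖u‖ + δ ∧ ‖u - y k‖ ≤ max 1 ‖u‖ + δ) ∧
      (∀ u ∈ S, ‖u‖ ≤ 2 - (1 / 2) ^ m) ∧
      ∀ c : Fin m → ℝ, (∀ k, |c k| = 1) → ∑ k, c k • y k ∈ S by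
    obtain ⟨y, S, h1, h2, h3⟩ := H
    exact ⟨y, h1, fun c hc => (h2 _ (h3 c hc)).trans (sub_le_self _ (by positivity))⟩
  induction m with
  | zero => exact ⟨fun k => k.elim0, {0}, fun k => k.elim0, by simp, by simp⟩
  | succ m ih =>
    obtain ⟨y, S, h1, h2, h3⟩ := ih
    have hη : 0 < min δ ((1 / 2) ^ (m + 1) : ℝ) := lt_min hδ (by positivity)
    obtain ⟨w, hw, hwT⟩ := hX.exists_norm_add_sub_le (T ∪ S) hη
    refine ⟨Fin.snoc y w, S.image (· + w) ∪ S.image (· - w), ?_, ?_, ?_⟩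
    · intro k
      induction k using Fin.lastCases with
      | last =>
        simp only [Fin.snoc_last]
        refine ⟨hw, fun u hu => ?_⟩
        have h := hwT u (Finset.mem_union_left _ hu)
        have h' := min_le_left δ ((1 / 2) ^ (m + 1) : ℝ)
        exact ⟨by linarith [h.1], by linarith [h.2]⟩
      | cast k => simpa only [Fin.snoc_castSucc] using h1 k
    · have hS : ∀ u ∈ S, max 1 ‖u‖ + min δ ((1 / 2) ^ (m + 1) : ℝ) ≤ 2 - (1 / 2) ^ (m + 1) := by
        intro u hu
        have h' := min_le_right δ ((1 / 2) ^ (m + 1) : ℝ)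
        have h4 : ((1 : ℝ) / 2) ^ m ≤ 1 := pow_le_one₀ (by norm_num) (by norm_num)
        have h5 : max 1 ‖u‖ ≤ 2 - (1 / 2) ^ m := max_le (by linarith) (h2 u hu)
        have h6 : ((1 : ℝ) / 2) ^ (m + 1) = (1 / 2) ^ m / 2 := by ring
        linarith
      intro u hu
      rcases Finset.mem_union.1 hu with hu | hu <;> obtain ⟨v, hv, rfl⟩ := Finset.mem_image.1 hu
      · exact (hwT v (Finset.mem_union_right _ hv)).1.trans (hS v hv)
      · exact (hwT v (Finset.mem_union_right _ hv)).2.trans (hS v hv)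
    · intro c hc
      have h := h3 (fun k => c k.castSucc) (fun k => hc _)
      rw [Fin.sum_univ_castSucc]
      simp only [Fin.snoc_castSucc, Fin.snoc_last]
      rcases eq_or_eq_neg_of_abs_eq (hc (Fin.last m)) with h' | h' <;> rw [h']
      · exact Finset.mem_union_left _ (Finset.mem_image.2 ⟨_, h, by simp⟩)
      · exact Finset.mem_union_right _ (Finset.mem_image.2 ⟨_, h, by simp [sub_eq_add_neg]⟩)

/-! ### Increments of scalar polynomials -/

/-- The diagonal sum of a real matrix is at most a value of its quadratic form at some vector of
signs. -/
theorem exists_signs_sum_diag_le {ι : Type*} (s : Finset ι) (a : ι → ι → ℝ) :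
    ∃ r : ι → ℝ, (∀ k, |r k| = 1) ∧
      ∑ k ∈ s, a k k ≤ ∑ k ∈ s, ∑ l ∈ s, r k * r l * a k l := by
  classical
  induction s using Finset.induction_on with
  | empty => exact ⟨fun _ => 1, by simp, by simp⟩
  | insert j s hj ih =>
    obtain ⟨r, hr, hle⟩ := ih
    set b : ℝ := ∑ l ∈ s, r l * a j l + ∑ k ∈ s, r k * a k j with hb
    -- The new sign makes the cross terms nonnegative; the new diagonal term is unaffected since `σ
    -- * σ = 1`.
    obtain ⟨σ, hσ, hσb⟩ : ∃ σ : ℝ, |σ| = 1 ∧ 0 ≤ σ * b := by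
      rcases le_total 0 b with h | h
      · exact ⟨1, by simp, by simpa using h⟩
      · exact ⟨-1, by simp, by simpa using h⟩
    have hσ2 : σ * σ = 1 := by rw [← abs_mul_abs_self, hσ, one_mul]
    have hne : ∀ k ∈ s, Function.update r j σ k = r k := fun k hk =>
      Function.update_of_ne (ne_of_mem_of_not_mem hk hj) _ _
    refine ⟨Function.update r j σ, fun k => ?_, ?_⟩
    · rcases eq_or_ne k j with rfl | h
      · simpa using hσ
      · simpa [h] using hr k
    · have h1 : ∑ k ∈ insert j s, ∑ l ∈ insert j s,
          Function.update r j σ k * Function.update r j σ l * a k l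
          = a j j + σ * b + ∑ k ∈ s, ∑ l ∈ s, r k * r l * a k l := by
        rw [Finset.sum_insert hj, Finset.sum_insert hj, Function.update_self]
        have h2 : ∑ l ∈ s, σ * Function.update r j σ l * a j l = σ * ∑ l ∈ s, r l * a j l := by
          rw [Finset.mul_sum]
          exact Finset.sum_congr rfl fun l hl => by rw [hne l hl]; ring
        have h3 : ∑ k ∈ s, ∑ l ∈ insert j s,
            Function.update r j σ k * Function.update r j σ l * a k l
            = σ * ∑ k ∈ s, r k * a k j + ∑ k ∈ s, ∑ l ∈ s, r k * r l * a k l := by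
          rw [Finset.mul_sum, ← Finset.sum_add_distrib]
          refine Finset.sum_congr rfl fun k hk => ?_
          rw [Finset.sum_insert hj, Function.update_self, hne k hk]
          congr 1
          · ring
          · exact Finset.sum_congr rfl fun l hl => by rw [hne l hl]
        rw [h2, h3, hσ2, hb]
        ring
      rw [h1, Finset.sum_insert hj]
      linarith

/-- A multilinear form applied to a constant family, with its first variable split off. -/
theorem ContinuousMultilinearMap.map_const_eq_curryLeft {N : ℕ} {X Y : Type*}
    [NormedAddCommGroup X] [NormedSpace ℝ X] [NormedAddCommGroup Y] [NormedSpace ℝ Y]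
    (M : ContinuousMultilinearMap ℝ (fun _ : Fin (N + 1) => X) Y) (v : X) :
    M (fun _ => v) = M.curryLeft v (fun _ => v) := by
  rw [ContinuousMultilinearMap.curryLeft_apply]
  congr 1
  ext i
  induction i using Fin.cases <;> rfl

/-- If all signed sums of a family are bounded by `C`, then the increments of a homogeneous scalar
polynomial along the members of the family are summable, uniformly in the family. -/
theorem exists_sum_increments_le {X : Type*} [NormedAddCommGroup X] [NormedSpace ℝ X]
    (x : X) {C : ℝ} (hC : 0 ≤ C) (N : ℕ) :
    ∃ K : ℝ, 0 ≤ K ∧ ∀ (M : ContinuousMultilinearMap ℝ (fun _ : Fin N => X) ℝ) (m : ℕ)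
      (y : Fin m → X), (∀ c : Fin m → ℝ, (∀ k, |c k| = 1) → ‖∑ k, c k • y k‖ ≤ C) →
      ∀ c : Fin m → ℝ, (∀ k, |c k| = 1) →
        ∑ k, c k * (M (fun _ => x + y k) - M (fun _ => x)) ≤ K * ‖M‖ := by
  induction N with
  | zero =>
    refine ⟨0, le_rfl, fun M m y _ c _ => ?_⟩
    have : ∀ k, M (fun _ => x + y k) = M (fun _ => x) := fun k => congrArg M (Subsingleton.elim _ _)
    simp [this]
  | succ N ih =>
    obtain ⟨K, hK, ih⟩ := ih
    refine ⟨K * ‖x‖ + K * C + C * ‖x‖ ^ N, by positivity, fun M m y hy c hc => ?_⟩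
    have hnorm : ∀ v, ‖M.curryLeft v‖ ≤ ‖M‖ * ‖v‖ := fun v => by
      simpa using M.curryLeft.le_opNorm v
    -- Only the first variable is peeled off, so `M` need not be symmetric.
    have split : ∀ k, M (fun _ => x + y k) - M (fun _ => x) =
        (M.curryLeft x (fun _ => x + y k) - M.curryLeft x (fun _ => x)) +
        (M.curryLeft (y k) (fun _ => x + y k) - M.curryLeft (y k) (fun _ => x)) +
        M.curryLeft (y k) (fun _ => x) := by
      intro k
      rw [M.map_const_eq_curryLeft, M.map_const_eq_curryLeft, map_add,
        add_apply]
      ring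
    have h1 : ∑ k, c k * (M.curryLeft x (fun _ => x + y k) - M.curryLeft x (fun _ => x))
        ≤ K * ‖x‖ * ‖M‖ := by
      refine (ih (M.curryLeft x) m y hy c hc).trans ?_
      calc K * ‖M.curryLeft x‖ ≤ K * (‖M‖ * ‖x‖) := mul_le_mul_of_nonneg_left (hnorm x) hK
        _ = K * ‖x‖ * ‖M‖ := by ring
    have h2 : ∑ k, c k * (M.curryLeft (y k) (fun _ => x + y k) - M.curryLeft (y k) (fun _ => x))
        ≤ K * C * ‖M‖ := by
      -- Here the form itself depends on `k`. Random signs decouple its two occurrences: the first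
      -- slot receives the single vector `∑ l, r l • y l`, of norm at most `C`, and the signs `r k *
      -- c k` are again admissible for the induction hypothesis.
      obtain ⟨r, hr, hle⟩ := exists_signs_sum_diag_le Finset.univ (fun k l : Fin m =>
        c k * (M.curryLeft (y l) (fun _ => x + y k) - M.curryLeft (y l) (fun _ => x)))
      refine hle.trans ?_
      have hw : ∀ u : X, M.curryLeft (∑ l, r l • y l) (fun _ => u)
          = ∑ l, r l * M.curryLeft (y l) (fun _ => u) := by
        intro u
        rw [map_sum, sum_apply]
        simp
      have heq : ∑ k, ∑ l, r k * r l *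
          (c k * (M.curryLeft (y l) (fun _ => x + y k) - M.curryLeft (y l) (fun _ => x)))
          = ∑ k, (r k * c k) * (M.curryLeft (∑ l, r l • y l) (fun _ => x + y k)
            - M.curryLeft (∑ l, r l • y l) (fun _ => x)) := by
        refine Finset.sum_congr rfl fun k _ => ?_
        rw [hw, hw, ← Finset.sum_sub_distrib, Finset.mul_sum]
        exact Finset.sum_congr rfl fun l _ => by ring
      rw [heq]
      refine (ih (M.curryLeft (∑ l, r l • y l)) m y hy (fun k => r k * c k)
        (fun k => by rw [abs_mul, hr, hc, one_mul])).trans ?_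
      calc K * ‖M.curryLeft (∑ l, r l • y l)‖ ≤ K * (‖M‖ * C) :=
            mul_le_mul_of_nonneg_left ((hnorm _).trans
              (mul_le_mul_of_nonneg_left (hy r hr) (norm_nonneg _))) hK
        _ = K * C * ‖M‖ := by ring
    have h3 : ∑ k, c k * M.curryLeft (y k) (fun _ => x) ≤ C * ‖x‖ ^ N * ‖M‖ := by
      have heq : ∑ k, c k * M.curryLeft (y k) (fun _ => x)
          = M.curryLeft (∑ k, c k • y k) (fun _ => x) := by
        rw [map_sum, sum_apply]
        simp
      rw [heq]
      calc M.curryLeft (∑ k, c k • y k) (fun _ => x)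
          ≤ ‖M.curryLeft (∑ k, c k • y k) (fun _ => x)‖ := Real.le_norm_self _
        _ ≤ ‖M.curryLeft (∑ k, c k • y k)‖ * ‖x‖ ^ N := by
            simpa using (M.curryLeft (∑ k, c k • y k)).le_opNorm (fun _ => x)
        _ ≤ (‖M‖ * C) * ‖x‖ ^ N := by
            gcongr
            exact (hnorm _).trans (mul_le_mul_of_nonneg_left (hy c hc) (norm_nonneg _))
        _ = C * ‖x‖ ^ N * ‖M‖ := by ring
    simp only [split, mul_add, Finset.sum_add_distrib, add_mul]
    linarith

/-- In an almost square space, finitely many scalar homogeneous polynomials are almost unchanged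
when passing from given points of the unit ball to their translates by a suitable companion. -/
theorem IsASQ.exists_small_increments {X : Type*} [NormedAddCommGroup X] [NormedSpace ℝ X]
    (hX : IsASQ X) {N : ℕ} {ι : Type*} [Fintype ι] (x : ι → X) (hx : ∀ i, ‖x i‖ ≤ 1)
    (M : ι → ContinuousMultilinearMap ℝ (fun _ : Fin N => X) ℝ) {δ : ℝ} (hδ : 0 < δ) :
    ∃ y : X, ‖y‖ = 1 ∧ ∀ i, ‖x i + y‖ ≤ 1 + δ ∧ ‖x i - y‖ ≤ 1 + δ ∧
      |M i (fun _ => x i + y) - M i (fun _ => x i)| ≤ δ := by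
  classical
  choose K hK hM using fun i => exists_sum_increments_le (x i) (zero_le_two (α := ℝ)) N
  -- If every member had total increment above `δ`, the sum over the `m` members would exceed the
  -- uniform bound.
  obtain ⟨m, hm⟩ := exists_nat_gt ((∑ i, K i * ‖M i‖) / δ)
  rw [div_lt_iff₀ hδ] at hm
  obtain ⟨y, hy, hyc⟩ := hX.exists_family (Finset.univ.image x) hδ m
  set D : ι → Fin m → ℝ := fun i k => M i (fun _ => x i + y k) - M i (fun _ => x i) with hD
  have habs : ∀ i, ∑ k, |D i k| ≤ K i * ‖M i‖ := by
    intro i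
    have h : ∀ k, ∃ c : ℝ, |c| = 1 ∧ |D i k| = c * D i k := by
      intro k
      rcases le_total 0 (D i k) with h | h
      · exact ⟨1, by simp, by rw [abs_of_nonneg h, one_mul]⟩
      · exact ⟨-1, by simp, by rw [abs_of_nonpos h, neg_one_mul]⟩
    choose c hc hcD using h
    rw [Finset.sum_congr rfl fun k _ => hcD k]
    exact hM i (M i) m y hyc c hc
  obtain ⟨k, hk⟩ : ∃ k, ∑ i, |D i k| ≤ δ := by
    by_contra! hcon
    have h1 : (m : ℝ) * δ ≤ ∑ k, ∑ i, |D i k| := by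
      have := Finset.sum_le_sum fun k (_ : k ∈ (Finset.univ : Finset (Fin m))) => (hcon k).le
      simpa using this
    rw [Finset.sum_comm] at h1
    have h2 := Finset.sum_le_sum fun i (_ : i ∈ (Finset.univ : Finset ι)) => habs i
    linarith
  refine ⟨y k, (hy k).1, fun i => ?_⟩
  have h := (hy k).2 (x i) (Finset.mem_image_of_mem _ (Finset.mem_univ i))
  rw [max_eq_left (hx i)] at h
  exact ⟨h.1, h.2,
    (Finset.single_le_sum (fun j _ => abs_nonneg (D j k)) (Finset.mem_univ i)).trans hk⟩

/-! ### Octahedrality of the polynomial space -/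

namespace HomPoly

variable {N : ℕ} {X Y : Type*} [NormedAddCommGroup X] [NormedSpace ℝ X]
  [NormedAddCommGroup Y] [NormedSpace ℝ Y]

/-- The polynomial `x ↦ f(x) ^ N • z`. -/
noncomputable def powSMul (N : ℕ) (f : X →L[ℝ] ℝ) (z : Y) : HomPoly N X Y :=
  ⟨fun x => f x ^ N • z,
    ((ContinuousMultilinearMap.mkPiRing ℝ (Fin N) z).compContinuousLinearMap fun _ => f),
    fun x => by simp⟩

theorem powSMul_apply (f : X →L[ℝ] ℝ) (z : Y) (x : X) : powSMul N f z x = f x ^ N • z := rfl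

theorem norm_le_of_forall (P : HomPoly N X Y) {C : ℝ} (h : ∀ x, ‖x‖ ≤ 1 → ‖P x‖ ≤ C) :
    ‖P‖ ≤ C :=
  ciSup_le fun x => h x (mem_closedBall_zero_iff.1 x.2)

theorem norm_powSMul {f : X →L[ℝ] ℝ} {z : Y} {y : X} (hf : ‖f‖ ≤ 1) (hy : ‖y‖ = 1)
    (hfy : f y = 1) (hz : ‖z‖ = 1) : ‖powSMul N f z‖ = 1 := by
  refine le_antisymm (norm_le_of_forall _ fun x hx => ?_) ?_
  · rw [powSMul_apply, norm_smul, hz, mul_one, norm_pow]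
    refine pow_le_one₀ (norm_nonneg _) ((f.le_opNorm x).trans ?_)
    exact mul_le_one₀ hf (norm_nonneg _) hx
  · have := (powSMul N f z).le_norm hy.le
    rwa [powSMul_apply, hfy, one_pow, one_smul, hz] at this

theorem exists_lt_norm_apply (P : HomPoly N X Y) {a : ℝ} (ha : a < ‖P‖) :
    ∃ x, ‖x‖ ≤ 1 ∧ a < ‖P x‖ := by
  obtain ⟨x, hx⟩ := exists_lt_of_lt_ciSup (norm_def P ▸ ha)
  exact ⟨x, mem_closedBall_zero_iff.1 x.2, hx⟩

theorem norm_apply_le (P : HomPoly N X Y) {x : X} {R : ℝ} (hR : 0 < R) (hx : ‖x‖ ≤ R) :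
    ‖P x‖ ≤ R ^ N * ‖P‖ := by
  have h : ‖R⁻¹ • x‖ ≤ 1 := by
    rw [norm_smul, norm_inv, Real.norm_of_nonneg hR.le, inv_mul_le_iff₀ hR, mul_one]
    exact hx
  have hxR : x = R • (R⁻¹ • x) := by rw [smul_inv_smul₀ hR.ne']
  rw [hxR, apply_smul, norm_smul, norm_pow, Real.norm_of_nonneg hR.le]
  exact mul_le_mul_of_nonneg_left (P.le_norm h) (by positivity)

/-- Octahedrality of the space of polynomials relative to finitely many norm one polynomials. -/
theorem exists_octahedral_of_fintype (hX : IsASQ X) (hY : HasOctahedralNorm Y) {ι : Type*}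
    [Fintype ι] (P : ι → HomPoly N X Y) (hP : ∀ i, ‖P i‖ = 1) {δ : ℝ} (hδ : 0 < δ)
    (hδ' : δ ≤ 1 / 2) :
    ∃ Q : HomPoly N X Y, ‖Q‖ = 1 ∧ ∀ i (t : ℝ),
      (1 - δ) ^ (N + 1) * (1 - 2 * δ) * (1 + |t|) ≤ (1 + δ) ^ N * ‖P i + t • Q‖ := by
  choose x hx hPx using fun i => (P i).exists_lt_norm_apply (a := 1 - δ) (by rw [hP]; linarith)
  choose M hM using fun i => (P i).2
  choose φ hφ hφx using fun i => exists_dual_vector'' ℝ (P i (x i))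
  obtain ⟨y, hy, hxy⟩ := hX.exists_small_increments x hx
    (fun i => (φ i).compContinuousMultilinearMap (M i)) hδ
  obtain ⟨f, hf, hfy⟩ := exists_dual_vector'' ℝ y
  rw [hy] at hfy
  obtain ⟨z, hz, hzF⟩ := hY δ hδ (Submodule.span ℝ (Set.range fun i => P i (x i + y)))
    (FiniteDimensional.span_of_finite ℝ (Set.finite_range _))
  refine ⟨powSMul N f z, norm_powSMul hf hy (by simpa using hfy) hz, fun i t => ?_⟩
  have hfy' : f y = 1 := by simpa using hfy
  obtain ⟨hadd, hsub, hinc⟩ := hxy i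
  have hPxy : 1 - 2 * δ ≤ ‖P i (x i + y)‖ := by
    have h1 : (φ i).compContinuousMultilinearMap (M i) (fun _ => x i + y) = φ i (P i (x i + y)) :=
      congrArg (φ i) (hM i _).symm
    have h2 : (φ i).compContinuousMultilinearMap (M i) (fun _ => x i) = ‖P i (x i)‖ :=
      (congrArg (φ i) (hM i _).symm).trans (by simpa using hφx i)
    rw [h1, h2] at hinc
    have h3 : φ i (P i (x i + y)) ≤ ‖P i (x i + y)‖ :=
      (Real.le_norm_self _).trans (((φ i).le_opNorm _).trans
        (mul_le_of_le_one_left (norm_nonneg _) (hφ i)))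
    linarith [(abs_le.1 hinc).1, hPx i]
  -- The bound on `x i - y` forces `f (x i) ≥ -δ`, while `f y = 1`.
  have hfx : 1 - δ ≤ f (x i + y) := by
    have h1 : -f (x i - y) ≤ 1 + δ := by
      refine (neg_le_abs _).trans (((f.le_opNorm _).trans
        (mul_le_of_le_one_left (norm_nonneg _) hf)).trans hsub)
    rw [map_sub, hfy'] at h1
    rw [map_add, hfy']
    linarith
  have hpow : (1 - δ) ^ N ≤ |f (x i + y) ^ N| :=
    (pow_le_pow_left₀ (by linarith) hfx N).trans (le_abs_self _)
  have hoct := hzF (P i (x i + y)) (Submodule.subset_span ⟨i, rfl⟩) (t * f (x i + y) ^ N)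
  have hle := (P i + t • powSMul N f z).norm_apply_le (by linarith : 0 < 1 + δ) hadd
  rw [add_apply, smul_apply, powSMul_apply, smul_smul] at hle
  refine le_trans ?_ (hoct.trans hle)
  rw [abs_mul, pow_succ', mul_assoc, mul_assoc]
  refine mul_le_mul_of_nonneg_left ?_ (by linarith)
  have h0 : 0 ≤ (1 - δ) ^ N := pow_nonneg (by linarith) N
  have h1 : (1 - δ) ^ N ≤ 1 := pow_le_one₀ (by linarith) (by linarith)
  have ht := abs_nonneg t
  have h2 : (1 - δ) ^ N * (1 - 2 * δ) ≤ 1 - 2 * δ := mul_le_of_le_one_left (by linarith) h1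
  have h3 : (1 - δ) ^ N * (1 - 2 * δ) ≤ (1 - δ) ^ N := mul_le_of_le_one_right h0 (by linarith)
  have h4 := mul_le_mul_of_nonneg_left (h3.trans hpow) ht
  linarith

end HomPoly

/-! ### Reduction to finitely many unit vectors -/

/-- To verify octahedrality, it suffices to consider finite families of unit vectors. -/
theorem hasOctahedralNorm_of_fintype {Z : Type*} [NormedAddCommGroup Z] [NormedSpace ℝ Z]
    (h : ∀ ε : ℝ, 0 < ε → ∀ (n : ℕ) (v : Fin n → Z), (∀ i, ‖v i‖ = 1) →
      ∃ z : Z, ‖z‖ = 1 ∧ ∀ i (t : ℝ), (1 - ε) * (1 + |t|) ≤ ‖v i + t • z‖) :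
    HasOctahedralNorm Z := by
  intro ε hε F hF
  have hcpt : IsCompact (Subtype.val '' (Metric.sphere (0 : F) 1)) :=
    (isCompact_sphere (0 : F) 1).image continuous_subtype_val
  -- Half of `ε` pays for the net, the other half for octahedrality on the net.
  obtain ⟨T, hTs, hTfin, hT⟩ := hcpt.finite_cover_balls (half_pos hε)
  have hT1 : ∀ v ∈ T, ‖v‖ = 1 := by
    intro v hv
    obtain ⟨w, hw, rfl⟩ := hTs hv
    simpa using hw
  obtain ⟨n, v, -, rfl⟩ := hTfin.fin_param
  obtain ⟨z, hz, hvz⟩ := h (ε / 2) (half_pos hε) n v fun i => hT1 _ ⟨i, rfl⟩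
  refine ⟨z, hz, fun y hy t => ?_⟩
  rcases eq_or_ne y 0 with rfl | hy0
  · rw [norm_zero, zero_add, zero_add, norm_smul, hz, mul_one, Real.norm_eq_abs]
    nlinarith [abs_nonneg t]
  have ha : 0 < ‖y‖ := norm_pos_iff.2 hy0
  have hunit : ‖‖y‖⁻¹ • y‖ = 1 := by
    rw [norm_smul, norm_inv, norm_norm, inv_mul_cancel₀ ha.ne']
  have hmem : ‖y‖⁻¹ • y ∈ Subtype.val '' (Metric.sphere (0 : F) 1) :=
    ⟨⟨‖y‖⁻¹ • y, F.smul_mem _ hy⟩, mem_sphere_zero_iff_norm.2 hunit, rfl⟩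
  obtain ⟨-, ⟨i, rfl⟩, hi⟩ := Set.mem_iUnion₂.1 (hT hmem)
  rw [mem_ball_iff_norm'] at hi
  have hscaled : (1 - ε) * (1 + |‖y‖⁻¹ * t|) ≤ ‖‖y‖⁻¹ • y + (‖y‖⁻¹ * t) • z‖ := by
    have h1 := hvz i (‖y‖⁻¹ * t)
    have h2 : ‖v i + (‖y‖⁻¹ * t) • z‖ ≤
        ‖v i - ‖y‖⁻¹ • y‖ + ‖‖y‖⁻¹ • y + (‖y‖⁻¹ * t) • z‖ := by
      refine le_trans (le_of_eq ?_) (norm_add_le _ _)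
      congr 1
      abel
    nlinarith [abs_nonneg (‖y‖⁻¹ * t)]
  have hy' : y + t • z = ‖y‖ • (‖y‖⁻¹ • y + (‖y‖⁻¹ * t) • z) := by
    rw [smul_add, smul_inv_smul₀ ha.ne', smul_smul, mul_inv_cancel_left₀ ha.ne']
  have ht : ‖y‖ + |t| = ‖y‖ * (1 + |‖y‖⁻¹ * t|) := by
    rw [abs_mul, abs_inv, abs_norm, mul_add, mul_one, mul_inv_cancel_left₀ ha.ne']
  rw [hy', norm_smul, norm_norm, ht, mul_left_comm]
  exact mul_le_mul_of_nonneg_left hscaled ha.le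

theorem corollary3p6 {X Y : Type*}
    [NormedAddCommGroup X] [NormedSpace ℝ X] [CompleteSpace X]
    [NormedAddCommGroup Y] [NormedSpace ℝ Y] [CompleteSpace Y]
    (hX : IsASQ X) (hY : HasOctahedralNorm Y) (N : ℕ) :
    HasOctahedralNorm (HomPoly N X Y) := by
  refine hasOctahedralNorm_of_fintype fun ε hε n P hP => ?_
  -- At `δ = 0` the difference equals `ε > 0`, so a small `δ` absorbs all the error factors.
  have hlim : Tendsto (fun δ : ℝ => (1 - δ) ^ (N + 1) * (1 - 2 * δ) - (1 - ε) * (1 + δ) ^ N)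
      (𝓝[>] 0) (𝓝 ε) := by
    refine Tendsto.mono_left ?_ nhdsWithin_le_nhds
    have hc : Continuous fun δ : ℝ =>
        (1 - δ) ^ (N + 1) * (1 - 2 * δ) - (1 - ε) * (1 + δ) ^ N := by fun_prop
    simpa using hc.tendsto 0
  obtain ⟨δ, hpos, hδ, hδ'⟩ := ((hlim.eventually_const_lt hε).and
    (Ioc_mem_nhdsGT (by norm_num : (0 : ℝ) < 1 / 2))).exists
  obtain ⟨Q, hQ, h⟩ := HomPoly.exists_octahedral_of_fintype hX hY P hP hδ hδ'
  refine ⟨Q, hQ, fun i t => ?_⟩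
  have hR : 0 < (1 + δ) ^ N := pow_pos (by linarith) N
  refine le_of_mul_le_mul_left (le_trans ?_ (h i t)) hR
  rw [← mul_assoc]
  exact mul_le_mul_of_nonneg_right (by linarith) (by positivity)
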